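/- **Theorem 4.2.** All locally convex spaces are real and Hausdorff. Let $V\neq\{0\}$ be a locally convex space, $\omega$ a continuous non-degenerate skew-symmetric bilinear form on $V$, and $\gamma\colon\mathbb R\to \mathrm{Sp}(V,\omega)$ a one-parameter group of continuous symplectic automorphisms such that $\mathbb R\times V\to V$, $(t,v)\mapsto\gamma(t)v$, is smooth (in the Michal–Bastiani sense), with infinitesimal generator $D=\gamma'(0)$. Let $G=\mathbb R\times V\times\mathbb R$ be the oscillator group with multiplication $$(z,v,t)(z',v',t')=\bigl(z+z'+\tfrac12\omega(v,\gamma(t)v'),\,v+\gamma(t)v',\,t+t'\bigr),$$ and let $\mathfrak g(V,\omega,D)=\mathbb R\times V\times\mathbb R$ be its Lie algebra, the (generalized) oscillator algebra, with bracket $$[(z,v,t),(z',v',t')]=(\omega(v,v'),\,tDv'-t'Dv,\,0).$$ Coadjoint orbits are the orbits of $\mathrm{Ad}^*(g)\lambda=\lambda\circ\mathrm{Ad}(g)^{-1}$, $g\in G$, on the topological dual $\mathfrak g'$; an orbit is *non-trivial* if it is not a single point. A set $E\subseteq\mathfrak g'$ is *semi-equicontinuous* if $s_E(x)=\sup\langle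 E,-x\rangle$ is bounded on a neighborhood of some point of $\mathfrak g$. A *euclidean locally convex space* $(W,\kappa)$ is a locally convex space $W$ with a continuous symmetric positive definite bilinear form $\kappa$. For a non-zero continuous $\kappa$-skew-symmetric operator $D'\colon W\to W$, the *double extension* $\mathfrak g(W,\kappa,D')$ is $\mathbb R\times W\times\mathbb R$ with the bracket $$[(z,w,t),(z',w',t')]=(\kappa(D'w,w'),\,tD'w'-t'D'w,\,0).$$ (1) The oscillator algebra $\mathfrak g(V,\omega,D)$ has a non-trivial semi-equicontinuous coadjoint orbit if and only if it is isomorphic, as a topological Lie algebra, to a double extension $\mathfrak g(W,\kappa,D')$ for some euclidean locally convex space $(W,\kappa)$ and some non-zero continuous $\kappa$-skew-symmetric operator $D'$ on $W$. (2) In this case one can take $W=V$ and $D'=D$, with $\kappa$ as follows. For some sign $\varepsilon\in\{1,-1\}$ the symmetric bilinear form $Q(x,y)=\omega(\varepsilon Dx,y)$ is positive definite on $V$, and if $V_Q\supseteq V$ denotes the Hilbert completion of $V$ with respect to $Q$, there is a continuous linear map $\eta\colon V\to V_Q$ with $Q(\eta(x),y)=\omega(x,y)$ for all $x,y\in V$.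 The form $$\kappa(x,y)=Q(\eta(x),\eta(y))$$ is a continuous, $\gamma(\mathbb R)$-invariant scalar product on $V$ for which $D$ is non-zero and skew-symmetric, and $\mathfrak g(V,\omega,D)\cong\mathfrak g(V,\kappa,D)$ as topological Lie algebras. -/

import Mathlib

open Filter Topology

universe u v

noncomputable section

/-! ### Smooth maps between locally convex spaces (Michal–Bastiani calculus) -/

/-- `y` is the derivative of `f` at `x` in the direction `h`. -/
def HasDirDerivAt {E : Type u} [AddCommGroup E] [Module ℝ E]
    {F : Type v} [AddCommGroup F] [Module ℝ F] [TopologicalSpace F]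
    (f : E → F) (x h : E) (y : F) : Prop :=
  Tendsto (fun s : ℝ => s⁻¹ • (f (x + s • h) - f x)) (𝓝[≠] 0) (𝓝 y)

/-- `f` is of class `C^k` in the sense of Michal–Bastiani: `C^0` means continuous, and `C^(k+1)`
means that `f` is continuous, that all directional derivatives exist, and that the resulting map
`df : E × E → F` is of class `C^k`. -/
def IsBastianiC {F : Type v} [AddCommGroup F] [Module ℝ F] [TopologicalSpace F] :
    ℕ → ∀ {E : Type u} [AddCommGroup E] [Module ℝ E] [TopologicalSpace E], (E → F) → Prop
  | 0, _, _, _, _, f => Continuous f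
  | k + 1, E, _, _, _, f => Continuous f ∧
      ∃ df : E × E → F, (∀ x h, HasDirDerivAt f x h (df (x, h))) ∧ IsBastianiC k df

/-- Smooth maps in the sense of Michal–Bastiani. -/
def IsBastianiSmooth {E : Type u} [AddCommGroup E] [Module ℝ E] [TopologicalSpace E]
    {F : Type v} [AddCommGroup F] [Module ℝ F] [TopologicalSpace F] (f : E → F) : Prop :=
  ∀ k : ℕ, IsBastianiC k f

/-! ### Semi-equicontinuous sets of functionals -/

/-- The support functional `s_E(x) = sup ⟨E, -x⟩`, with values in `[-∞, ∞]`. -/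
def supportFunctional {X : Type u} [AddCommGroup X] [Module ℝ X] [TopologicalSpace X]
    (E : Set (X →L[ℝ] ℝ)) (x : X) : EReal :=
  ⨆ α ∈ E, ((α (-x) : ℝ) : EReal)

/-- `E ⊆ X'` is semi-equicontinuous if its support functional is (finite and) bounded on a
neighborhood of some point. -/
def IsSemiEquicontinuous {X : Type u} [AddCommGroup X] [Module ℝ X] [TopologicalSpace X]
    (E : Set (X →L[ℝ] ℝ)) : Prop :=
  ∃ x₀ : X, ∃ U ∈ 𝓝 x₀, ∃ C : ℝ, ∀ x ∈ U,
    ((-C : ℝ) : EReal) ≤ supportFunctional E x ∧ supportFunctional E x ≤ (C : EReal)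

/-! ### The Lie algebra `(ℝ ⊕_ω V) ⋊_D ℝ` -/

/-- A continuous alternating bilinear form `ω` on `V` and a continuous operator `D` which is
skew for `ω`, i.e. a derivation of the Heisenberg algebra `ℝ ⊕_ω V`. -/
structure HeisDerivation (V : Type u) [AddCommGroup V] [Module ℝ V] [TopologicalSpace V] where
  /-- the alternating form -/
  ω : V →ₗ[ℝ] V →ₗ[ℝ] ℝ
  /-- the operator -/
  D : V →L[ℝ] V
  continuous_ω : Continuous fun p : V × V => ω p.1 p.2
  alt : ∀ x, ω x x = 0
  skew : ∀ x y, ω (D x) y + ω x (D y) = 0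

namespace HeisDerivation

section

variable {V : Type u} [AddCommGroup V] [Module ℝ V] [TopologicalSpace V]

theorem swap (S : HeisDerivation V) (x y : V) : S.ω x y = -S.ω y x := by
  have h := S.alt (x + y)
  simp only [map_add, LinearMap.add_apply, S.alt] at h
  linarith

/-- The underlying space `ℝ × V × ℝ` of `(ℝ ⊕_ω V) ⋊_D ℝ`; elements are triples `(z, v, t)`. -/
def Alg (_S : HeisDerivation V) : Type u := ℝ × V × ℝ

variable (S : HeisDerivation V)

instance : AddCommGroup S.Alg := inferInstanceAs (AddCommGroup (ℝ × V × ℝ))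

instance : Module ℝ S.Alg := inferInstanceAs (Module ℝ (ℝ × V × ℝ))

instance : TopologicalSpace S.Alg := inferInstanceAs (TopologicalSpace (ℝ × V × ℝ))

/-- `[(z,v,t), (z',v',t')] = (ω(v,v'), t D v' - t' D v, 0)`. -/
instance : Bracket S.Alg S.Alg :=
  ⟨fun a b => ((S.ω a.2.1 b.2.1, a.2.2 • S.D b.2.1 - b.2.2 • S.D a.2.1, 0) : ℝ × V × ℝ)⟩

theorem bracket_def (a b : S.Alg) :
    ⁅a, b⁆ = ((S.ω a.2.1 b.2.1, a.2.2 • S.D b.2.1 - b.2.2 • S.D a.2.1, 0) : ℝ × V × ℝ) := rfl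

instance : LieRing S.Alg where
  add_lie := by
    rintro ⟨z, v, t⟩ ⟨z', v', t'⟩ ⟨z'', v'', t''⟩
    change ((_, _, _) : ℝ × V × ℝ) = (_ + _, _ + _, _ + _)
    refine Prod.ext ?_ (Prod.ext ?_ ?_)
    · change S.ω (v + v') v'' = S.ω v v'' + S.ω v' v''
      simp
    · change (t + t') • S.D v'' - t'' • S.D (v + v') =
        (t • S.D v'' - t'' • S.D v) + (t' • S.D v'' - t'' • S.D v')
      rw [map_add]; module
    · change (0 : ℝ) = 0 + 0
      simp
  lie_add := by
    rintro ⟨z, v, t⟩ ⟨z', v', t'⟩ ⟨z'', v'', t''⟩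
    change ((_, _, _) : ℝ × V × ℝ) = (_ + _, _ + _, _ + _)
    refine Prod.ext ?_ (Prod.ext ?_ ?_)
    · change S.ω v (v' + v'') = S.ω v v' + S.ω v v''
      simp
    · change t • S.D (v' + v'') - (t' + t'') • S.D v =
        (t • S.D v' - t' • S.D v) + (t • S.D v'' - t'' • S.D v)
      rw [map_add]; module
    · change (0 : ℝ) = 0 + 0
      simp
  lie_self := by
    rintro ⟨z, v, t⟩
    refine Prod.ext ?_ (Prod.ext ?_ rfl)
    · exact S.alt v
    · exact sub_self _
  leibniz_lie := by
    rintro ⟨z, v, t⟩ ⟨z', v', t'⟩ ⟨z'', v'', t''⟩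
    refine Prod.ext ?_ (Prod.ext ?_ ?_)
    · change S.ω v (t' • S.D v'' - t'' • S.D v') =
        S.ω (t • S.D v' - t' • S.D v) v'' + S.ω v' (t • S.D v'' - t'' • S.D v)
      have h1 := S.skew v v''
      have h2 := S.skew v' v''
      have h3 := S.skew v v'
      have h4 := S.swap v' (S.D v)
      simp only [map_sub, map_smul, LinearMap.sub_apply, LinearMap.smul_apply, smul_eq_mul]
      linear_combination t' * h1 - t * h2 - t'' * h3 + t'' * h4
    · change t • S.D (t' • S.D v'' - t'' • S.D v') - (0 : ℝ) • S.D v =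
        ((0 : ℝ) • S.D v'' - t'' • S.D (t • S.D v' - t' • S.D v)) +
          (t' • S.D (t • S.D v'' - t'' • S.D v) - (0 : ℝ) • S.D v')
      simp only [map_sub, map_smul]
      module
    · change (0 : ℝ) = 0 + 0
      simp

instance : LieAlgebra ℝ S.Alg where
  lie_smul := by
    rintro c ⟨z, v, t⟩ ⟨z', v', t'⟩
    refine Prod.ext ?_ (Prod.ext ?_ ?_)
    · change S.ω v (c • v') = c • S.ω v v'
      simp
    · change t • S.D (c • v') - (c * t') • S.D v = c • (t • S.D v' - t' • S.D v)
      rw [map_smul]; module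
    · change (0 : ℝ) = c * 0
      simp

end

/-- Isomorphism of topological Lie algebras. -/
def TopLieIso {V : Type u} [AddCommGroup V] [Module ℝ V] [TopologicalSpace V]
    {W : Type v} [AddCommGroup W] [Module ℝ W] [TopologicalSpace W]
    (S : HeisDerivation V) (T : HeisDerivation W) : Prop :=
  ∃ e : S.Alg ≃ₗ⁅ℝ⁆ T.Alg, Continuous e ∧ Continuous e.symm

end HeisDerivation

/-! ### Double extensions of euclidean locally convex spaces -/

/-- The data of a double extension of `V`: a continuous scalar product `κ` on `V` (so that `(V, κ)`
is a euclidean locally convex space) and a non-zero continuous `κ`-skew-symmetric operator `D`. -/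
structure DoubleExtData (V : Type u) [AddCommGroup V] [Module ℝ V] [TopologicalSpace V] where
  /-- the scalar product -/
  κ : V →ₗ[ℝ] V →ₗ[ℝ] ℝ
  continuous_κ : Continuous fun p : V × V => κ p.1 p.2
  symm : ∀ x y, κ x y = κ y x
  pos_def : ∀ x, x ≠ 0 → 0 < κ x x
  /-- the skew-symmetric operator -/
  D : V →L[ℝ] V
  skew : ∀ x y, κ (D x) y = -κ x (D y)
  D_ne_zero : D ≠ 0

/-- The double extension `𝔤(V,κ,D) = (ℝ ⊕_{ω_D} V) ⋊_D ℝ`, where `ω_D(x,y) = κ(Dx,y)`. -/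
def DoubleExtData.toHeis {V : Type u} [AddCommGroup V] [Module ℝ V] [TopologicalSpace V]
    (T : DoubleExtData V) : HeisDerivation V where
  ω := T.κ.comp T.D.toLinearMap
  D := T.D
  continuous_ω := by
    have h : Continuous fun p : V × V => (T.D p.1, p.2) := by fun_prop
    exact T.continuous_κ.comp h
  alt x := by
    change T.κ (T.D x) x = 0
    have h1 := T.skew x x
    have h2 := T.symm x (T.D x)
    linarith
  skew x y := by
    change T.κ (T.D (T.D x)) y + T.κ (T.D x) (T.D y) = 0
    rw [T.skew (T.D x) y]
    ring

/-! ### Oscillator groups and oscillator algebras -/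

/-- A locally convex symplectic space `(V, ω)` with a one-parameter group `γ : ℝ → Sp(V, ω)`
defining a smooth action of `ℝ` on `V`. -/
structure OscillatorData (V : Type u) [AddCommGroup V] [Module ℝ V] [TopologicalSpace V] where
  /-- the symplectic form -/
  ω : V →ₗ[ℝ] V →ₗ[ℝ] ℝ
  continuous_ω : Continuous fun p : V × V => ω p.1 p.2
  alt : ∀ x, ω x x = 0
  nondegenerate : ∀ x, (∀ y, ω x y = 0) → x = 0
  /-- the one-parameter group -/
  γ : ℝ → V →L[ℝ] V
  γ_zero : γ 0 = ContinuousLinearMap.id ℝ V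
  γ_add : ∀ s t, γ (s + t) = (γ s).comp (γ t)
  γ_symplectic : ∀ t x y, ω (γ t x) (γ t y) = ω x y
  γ_smooth : IsBastianiSmooth fun p : ℝ × V => γ p.1 p.2

namespace OscillatorData

variable {V : Type u} [AddCommGroup V] [Module ℝ V] [TopologicalSpace V]

theorem tendsto_γ (S : OscillatorData V) (v : V) :
    Tendsto (fun s : ℝ => S.γ s v) (𝓝 0) (𝓝 v) := by
  have h : Continuous fun p : ℝ × V => S.γ p.1 p.2 := S.γ_smooth 0
  have h2 : Continuous fun s : ℝ => S.γ s v := h.comp (by fun_prop : Continuous fun s : ℝ => (s, v))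
  simpa [S.γ_zero] using h2.tendsto 0

theorem swap (S : OscillatorData V) (x y : V) : S.ω x y = -S.ω y x := by
  have h := S.alt (x + y)
  simp only [map_add, LinearMap.add_apply, S.alt] at h
  linarith

variable [IsTopologicalAddGroup V] [ContinuousSMul ℝ V] [T2Space V]

theorem exists_generator (S : OscillatorData V) :
    ∃ D : V →L[ℝ] V, ∀ v, HasDirDerivAt (fun t : ℝ => S.γ t v) 0 1 (D v) := by
  obtain ⟨-, df, hdf, hc⟩ := S.γ_smooth 1
  have hc : Continuous df := hc
  have key : ∀ v, HasDirDerivAt (fun t : ℝ => S.γ t v) 0 1 (df ((0, v), (1, 0))) := by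
    intro v
    have := hdf (0, v) (1, 0)
    simpa [HasDirDerivAt] using this
  refine ⟨⟨⟨⟨fun v => df ((0, v), (1, 0)), ?_⟩, ?_⟩, ?_⟩, key⟩
  · intro v w
    refine tendsto_nhds_unique (key (v + w)) (((key v).add (key w)).congr fun s => ?_)
    simp only [map_add]
    rw [← smul_add]
    congr 1
    abel
  · intro c v
    refine tendsto_nhds_unique (key (c • v)) (((key v).const_smul c).congr fun s => ?_)
    simp only [map_smul]
    rw [smul_comm, smul_sub]
  · exact hc.comp (by fun_prop)

/-- The infinitesimal generator `D = γ'(0)` of `γ`. -/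
def D (S : OscillatorData V) : V →L[ℝ] V := S.exists_generator.choose

theorem D_spec (S : OscillatorData V) (v : V) :
    HasDirDerivAt (fun t : ℝ => S.γ t v) 0 1 (S.D v) := S.exists_generator.choose_spec v

theorem tendsto_D (S : OscillatorData V) (v : V) :
    Tendsto (fun s : ℝ => s⁻¹ • (S.γ s v - v)) (𝓝[≠] 0) (𝓝 (S.D v)) := by
  have := S.D_spec v
  simpa [HasDirDerivAt, S.γ_zero] using this

theorem D_skew (S : OscillatorData V) (x y : V) : S.ω (S.D x) y + S.ω x (S.D y) = 0 := by
  have h1 : Tendsto (fun s : ℝ => S.ω (s⁻¹ • (S.γ s x - x)) (S.γ s y)) (𝓝[≠] 0)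
      (𝓝 (S.ω (S.D x) y)) :=
    (S.continuous_ω.tendsto (S.D x, y)).comp
      ((S.tendsto_D x).prodMk_nhds ((S.tendsto_γ y).mono_left nhdsWithin_le_nhds))
  have h2 : Tendsto (fun s : ℝ => S.ω x (s⁻¹ • (S.γ s y - y))) (𝓝[≠] 0)
      (𝓝 (S.ω x (S.D y))) :=
    (S.continuous_ω.tendsto (x, S.D y)).comp (tendsto_const_nhds.prodMk_nhds (S.tendsto_D y))
  refine tendsto_nhds_unique (h1.add h2) (tendsto_const_nhds.congr fun s => ?_)
  simp only [map_smul, map_sub, LinearMap.smul_apply, LinearMap.sub_apply, S.γ_symplectic,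
    smul_eq_mul]
  ring

/-- The data defining the oscillator algebra `𝔤(V,ω,D) = heis(V,ω) ⋊_D ℝ`. -/
def toHeis (S : OscillatorData V) : HeisDerivation V where
  ω := S.ω
  D := S.D
  continuous_ω := S.continuous_ω
  alt := S.alt
  skew := S.D_skew

/-- The oscillator group `G(V,ω,γ) = Heis(V,ω) ⋊_γ ℝ`; elements are triples `(z, v, t)`. -/
def Grp (_S : OscillatorData V) : Type u := ℝ × V × ℝ

/-- `(z,v,t)(z',v',t') = (z + z' + ½ ω(v, γ(t)v'), v + γ(t)v', t + t')`. -/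
instance (S : OscillatorData V) : Mul S.Grp :=
  ⟨fun g h => ((g.1 + h.1 + 1 / 2 * S.ω g.2.1 (S.γ g.2.2 h.2.1),
    g.2.1 + S.γ g.2.2 h.2.1, g.2.2 + h.2.2) : ℝ × V × ℝ)⟩

instance (S : OscillatorData V) : One S.Grp := ⟨((0, 0, 0) : ℝ × V × ℝ)⟩

instance (S : OscillatorData V) : Inv S.Grp :=
  ⟨fun g => ((-g.1, -S.γ (-g.2.2) g.2.1, -g.2.2) : ℝ × V × ℝ)⟩

instance (S : OscillatorData V) : Group S.Grp :=
  Group.ofLeftAxioms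
    (by
      rintro ⟨z, v, t⟩ ⟨z', v', t'⟩ ⟨z'', v'', t''⟩
      refine Prod.ext ?_ (Prod.ext ?_ ?_)
      · change z + z' + 1 / 2 * S.ω v (S.γ t v') + z'' +
            1 / 2 * S.ω (v + S.γ t v') (S.γ (t + t') v'') =
          z + (z' + z'' + 1 / 2 * S.ω v' (S.γ t' v'')) +
            1 / 2 * S.ω v (S.γ t (v' + S.γ t' v''))
        simp only [S.γ_add, map_add, LinearMap.add_apply, ContinuousLinearMap.comp_apply,
          S.γ_symplectic]
        ring
      · change v + S.γ t v' + S.γ (t + t') v'' = v + S.γ t (v' + S.γ t' v'')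
        simp only [S.γ_add, map_add, ContinuousLinearMap.comp_apply]
        abel
      · exact add_assoc t t' t'')
    (by
      rintro ⟨z, v, t⟩
      refine Prod.ext ?_ (Prod.ext ?_ ?_)
      · change 0 + z + 1 / 2 * S.ω 0 (S.γ 0 v) = z
        simp
      · change 0 + S.γ 0 v = v
        simp [S.γ_zero]
      · exact zero_add t)
    (by
      rintro ⟨z, v, t⟩
      refine Prod.ext ?_ (Prod.ext ?_ ?_)
      · change -z + z + 1 / 2 * S.ω (-S.γ (-t) v) (S.γ (-t) v) = 0
        simp [S.alt]
      · change -S.γ (-t) v + S.γ (-t) v = 0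
        simp
      · exact neg_add_cancel t)

/-- The adjoint action of the oscillator group on its Lie algebra,
`Ad(z,v,t)(z',v',t') = (z' + ω(v, γ(t)v') + ½ t' ω(Dv,v), γ(t)v' - t' Dv, t')`.
By `hasDirDerivAt_conj` below it is the derivative at the unit of the conjugation by `(z,v,t)`. -/
def Ad (S : OscillatorData V) (g : S.Grp) : S.toHeis.Alg →L[ℝ] S.toHeis.Alg where
  toFun a := ((a.1 + S.ω g.2.1 (S.γ g.2.2 a.2.1) + a.2.2 / 2 * S.ω (S.D g.2.1) g.2.1,
    S.γ g.2.2 a.2.1 - a.2.2 • S.D g.2.1, a.2.2) : ℝ × V × ℝ)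
  map_add' := by
    rintro ⟨z, v, t⟩ ⟨z', v', t'⟩
    refine Prod.ext ?_ (Prod.ext ?_ ?_)
    · change z + z' + S.ω g.2.1 (S.γ g.2.2 (v + v')) + (t + t') / 2 * S.ω (S.D g.2.1) g.2.1 =
        (z + S.ω g.2.1 (S.γ g.2.2 v) + t / 2 * S.ω (S.D g.2.1) g.2.1) +
        (z' + S.ω g.2.1 (S.γ g.2.2 v') + t' / 2 * S.ω (S.D g.2.1) g.2.1)
      simp only [map_add]
      ring
    · change S.γ g.2.2 (v + v') - (t + t') • S.D g.2.1 =
        (S.γ g.2.2 v - t • S.D g.2.1) + (S.γ g.2.2 v' - t' • S.D g.2.1)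
      rw [map_add]; module
    · rfl
  map_smul' := by
    rintro c ⟨z, v, t⟩
    refine Prod.ext ?_ (Prod.ext ?_ ?_)
    · change c * z + S.ω g.2.1 (S.γ g.2.2 (c • v)) + (c * t) / 2 * S.ω (S.D g.2.1) g.2.1 =
        c * (z + S.ω g.2.1 (S.γ g.2.2 v) + t / 2 * S.ω (S.D g.2.1) g.2.1)
      simp only [map_smul, smul_eq_mul]
      ring
    · change S.γ g.2.2 (c • v) - (c * t) • S.D g.2.1 = c • (S.γ g.2.2 v - t • S.D g.2.1)
      rw [map_smul]; module
    · rfl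
  cont := by
    have h : Continuous fun a : ℝ × V × ℝ => S.ω g.2.1 (S.γ g.2.2 a.2.1) :=
      S.continuous_ω.comp
        (by fun_prop : Continuous fun a : ℝ × V × ℝ => (g.2.1, S.γ g.2.2 a.2.1))
    change Continuous fun a : ℝ × V × ℝ =>
      ((a.1 + S.ω g.2.1 (S.γ g.2.2 a.2.1) + a.2.2 / 2 * S.ω (S.D g.2.1) g.2.1,
        S.γ g.2.2 a.2.1 - a.2.2 • S.D g.2.1, a.2.2) : ℝ × V × ℝ)
    fun_prop

theorem hasDirDerivAt_conj (S : OscillatorData V) (g : S.Grp) (a : S.toHeis.Alg) :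
    HasDirDerivAt (E := ℝ × V × ℝ) (F := ℝ × V × ℝ)
      (fun x => g * (show S.Grp from x) * g⁻¹) 0 a (S.Ad g a) := by
  obtain ⟨z, v, t⟩ := g
  obtain ⟨z', v', t'⟩ := a
  have hγ : Tendsto (fun s : ℝ => S.γ (s * t') v) (𝓝[≠] 0) (𝓝 v) := by
    have : Tendsto (fun s : ℝ => s * t') (𝓝[≠] 0) (𝓝 0) := by
      have h : Continuous fun s : ℝ => s * t' := by fun_prop
      simpa using (h.tendsto 0).mono_left nhdsWithin_le_nhds
    exact (S.tendsto_γ v).comp this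
  have hD : Tendsto (fun s : ℝ => s⁻¹ • (S.γ (s * t') v - v)) (𝓝[≠] 0) (𝓝 (t' • S.D v)) := by
    by_cases ht : t' = 0
    · subst ht
      simp [S.γ_zero]
    · have h0 : Tendsto (fun s : ℝ => s * t') (𝓝[≠] 0) (𝓝[≠] 0) := by
        refine tendsto_nhdsWithin_iff.2 ⟨?_, ?_⟩
        · have h : Continuous fun s : ℝ => s * t' := by fun_prop
          simpa using (h.tendsto 0).mono_left nhdsWithin_le_nhds
        · filter_upwards [self_mem_nhdsWithin] with s hs
          exact mul_ne_zero hs ht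
      refine (((S.tendsto_D v).comp h0).const_smul t').congr fun s => ?_
      simp only [Function.comp_apply, smul_smul]
      congr 1
      rw [mul_inv, mul_comm, mul_assoc, inv_mul_cancel₀ ht, mul_one]
  have hω1 : Tendsto (fun s : ℝ => S.ω v (s⁻¹ • (S.γ (s * t') v - v))) (𝓝[≠] 0)
      (𝓝 (S.ω v (t' • S.D v))) :=
    (S.continuous_ω.tendsto (v, t' • S.D v)).comp (tendsto_const_nhds.prodMk_nhds hD)
  have hω2 : Tendsto (fun s : ℝ => S.ω (S.γ t v') (S.γ (s * t') v)) (𝓝[≠] 0)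
      (𝓝 (S.ω (S.γ t v') v)) :=
    (S.continuous_ω.tendsto (S.γ t v', v)).comp (tendsto_const_nhds.prodMk_nhds hγ)
  have hγγ : ∀ s : ℝ, S.γ (t + s * t') (S.γ (-t) v) = S.γ (s * t') v := by
    intro s
    rw [← ContinuousLinearMap.comp_apply, ← S.γ_add]
    congr 2
    ring
  have hz : Tendsto (fun s : ℝ => s⁻¹ * ((z + s * z' + 1 / 2 * S.ω v (S.γ t (s • v')) + -z +
        1 / 2 * S.ω (v + S.γ t (s • v')) (S.γ (t + s * t') (-S.γ (-t) v))) - 0)) (𝓝[≠] 0)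
      (𝓝 (z' + S.ω v (S.γ t v') + t' / 2 * S.ω (S.D v) v)) := by
    have h := ((tendsto_const_nhds (x := z' + 1 / 2 * S.ω v (S.γ t v'))).sub
      (hω1.const_mul (1 / 2))).sub (hω2.const_mul (1 / 2))
    have e : z' + 1 / 2 * S.ω v (S.γ t v') - 1 / 2 * S.ω v (t' • S.D v) -
        1 / 2 * S.ω (S.γ t v') v = z' + S.ω v (S.γ t v') + t' / 2 * S.ω (S.D v) v := by
      rw [S.swap (S.γ t v') v, S.swap (S.D v) v, map_smul, smul_eq_mul]
      ring
    rw [e] at h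
    refine h.congr' ?_
    filter_upwards [self_mem_nhdsWithin] with s hs
    have hs : s ≠ 0 := hs
    simp only [map_neg, hγγ, map_add, map_smul, map_sub, LinearMap.add_apply,
      LinearMap.smul_apply, smul_eq_mul, S.alt]
    field_simp
    ring
  have hv : Tendsto (fun s : ℝ => s⁻¹ • ((v + S.γ t (s • v') +
        S.γ (t + s * t') (-S.γ (-t) v)) - 0)) (𝓝[≠] 0) (𝓝 (S.γ t v' - t' • S.D v)) := by
    refine (tendsto_const_nhds.sub hD).congr' ?_
    filter_upwards [self_mem_nhdsWithin] with s hs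
    have hs : s ≠ 0 := hs
    rw [map_neg, hγγ, map_smul]
    have : v + s • S.γ t v' + -S.γ (s * t') v - 0 = s • S.γ t v' - (S.γ (s * t') v - v) := by
      abel
    rw [this, smul_sub s⁻¹ (s • S.γ t v'), smul_smul, inv_mul_cancel₀ hs, one_smul]
  have ht : Tendsto (fun s : ℝ => s⁻¹ * ((t + s * t' + -t) - 0)) (𝓝[≠] 0) (𝓝 t') := by
    refine tendsto_const_nhds.congr' ?_
    filter_upwards [self_mem_nhdsWithin] with s hs
    have hs : s ≠ 0 := hs
    field_simp
    ring
  refine (hz.prodMk_nhds (hv.prodMk_nhds ht)).congr fun s => ?_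
  let g : S.Grp := ((z, v, t) : ℝ × V × ℝ)
  have h1 : g * (show S.Grp from (0 : ℝ × V × ℝ)) * g⁻¹ = (0 : ℝ × V × ℝ) := by
    have h : (show S.Grp from (0 : ℝ × V × ℝ)) = 1 := rfl
    rw [h, mul_one, mul_inv_cancel]
    rfl
  have h2 : (0 : ℝ × V × ℝ) + s • ((z', v', t') : ℝ × V × ℝ) = (s * z', s • v', s * t') := by
    rw [zero_add]; rfl
  change _ = s⁻¹ • ((show ℝ × V × ℝ from g * (show S.Grp from
    (0 : ℝ × V × ℝ) + s • ((z', v', t') : ℝ × V × ℝ)) * g⁻¹) -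
      (show ℝ × V × ℝ from g * (show S.Grp from (0 : ℝ × V × ℝ)) * g⁻¹))
  rw [h1, h2]
  rfl

/-- The coadjoint action `Ad*(g)λ = λ ∘ Ad(g)⁻¹` on the topological dual of the Lie algebra. -/
def coAd (S : OscillatorData V) (g : S.Grp) (l : S.toHeis.Alg →L[ℝ] ℝ) :
    S.toHeis.Alg →L[ℝ] ℝ :=
  l.comp (S.Ad g⁻¹)

/-- The coadjoint orbit of `λ`. -/
def coadjointOrbit (S : OscillatorData V) (l : S.toHeis.Alg →L[ℝ] ℝ) :
    Set (S.toHeis.Alg →L[ℝ] ℝ) :=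
  Set.range fun g : S.Grp => S.coAd g l

/-- There is a non-trivial (not a singleton) semi-equicontinuous coadjoint orbit. -/
def HasNontrivialSemiEquicontinuousOrbit (S : OscillatorData V) : Prop :=
  ∃ l : S.toHeis.Alg →L[ℝ] ℝ, S.coadjointOrbit l ≠ {l} ∧ IsSemiEquicontinuous (S.coadjointOrbit l)

end OscillatorData

/-- `ι : V → H` exhibits the Hilbert space `H` as the Hilbert completion `V_Q` of `V` with respect
to the scalar product `Q`. -/
structure IsHilbertCompletion {V : Type u} [AddCommGroup V] [Module ℝ V]
    {H : Type v} [NormedAddCommGroup H] [InnerProductSpace ℝ H]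
    (Q : V → V → ℝ) (ι : V →ₗ[ℝ] H) : Prop where
  complete : CompleteSpace H
  dense : DenseRange ι
  inner_eq : ∀ x y, inner ℝ (ι x) (ι y) = Q x y

end

/-! From an orbit to a scalar product. Write `λ = (c, α, τ)` and evaluate the orbit along
`Ad(0,v,0)` at a point `(z₀,u,t₁)` with `t₁ ≠ 0`. The result is a polynomial in `v` with quadratic
part `(c t₁/2) ω(Dv,v)` and linear part `c ω(v,u) - t₁ α(Dv)`, and semi-equicontinuity bounds it
below uniformly for `u` in an open set (`exists_orbit_bound`). If `c = 0`, the linear part must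
vanish and `λ` is fixed by the group, so a non-trivial orbit has `c ≠ 0`
(`central_component_ne_zero`). Then `Q = ω(εD·,·)` is positive semidefinite, with `ε` the sign of `c
t₁`, and the discriminant inequality controls the linear part by `√Q`. Subtracting two values of `u`
leaves `|ω(u,v)| ≤ M √Q(v,v)` for all `u` near `0` (`exists_pos_and_bound`). Non-degeneracy of `ω`
makes `Q` definite, and Riesz representation turns the estimate into a continuous `η : V → V_Q`
(`exists_continuousLinearMap_riesz`). Since `ηD = ε ι`, the form `κ = ⟨η·,η·⟩` satisfies `κ(Dx,y) =
-ε ω(x,y)`, so rescaling the centre gives the isomorphism.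

From a double extension to an orbit. The form `2zt + κ(w,w)` is Lorentzian in nature and
ad-invariant. Transported to the oscillator algebra it is `Ad`-invariant (`invariant_Ad`), and so is
the coordinate `t`, which is the pairing with a central element. On an `Ad`-orbit with `t < 0` the
equation `z = (B(a,a) - κ(w,w)) / (2t)` and `κ ≥ 0` bound `z` below by `B(a,a) / (2t)`, a continuous
function of the starting point. Hence the functional `z` has a semi-equicontinuous orbit. It is
non-trivial because `D' ≠ 0` keeps `(0,0,1)` out of the centre (`hasOrbit_of_topLieIso`). -/

/-! ### Hilbert completions -/

/-- A real vector space regarded as a pre-Hilbert space for a given scalar product. -/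
def PreHilbert {V : Type u} [AddCommGroup V] [Module ℝ V] (_Q : InnerProductSpace.Core ℝ V) :
    Type u := V

namespace PreHilbert

variable {V : Type u} [AddCommGroup V] [Module ℝ V] (Q : InnerProductSpace.Core ℝ V)

noncomputable instance : NormedAddCommGroup (PreHilbert Q) := Q.toNormedAddCommGroup

noncomputable instance : InnerProductSpace ℝ (PreHilbert Q) := InnerProductSpace.ofCore Q.toCore

/-- The identity, as a linear map into the pre-Hilbert space. -/
def of : V →ₗ[ℝ] PreHilbert Q where
  toFun x := x
  map_add' _ _ := rfl
  map_smul' _ _ := rfl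

theorem inner_of (x y : V) : inner ℝ (of Q x) (of Q y) = Q.inner x y := rfl

end PreHilbert

theorem exists_isHilbertCompletion {V : Type u} [AddCommGroup V] [Module ℝ V]
    (Q : V →ₗ[ℝ] V →ₗ[ℝ] ℝ) (hsymm : ∀ x y, Q x y = Q y x) (hpos : ∀ x, x ≠ 0 → 0 < Q x x) :
    ∃ (H : Type u) (_ : NormedAddCommGroup H) (_ : InnerProductSpace ℝ H) (ι : V →ₗ[ℝ] H),
      IsHilbertCompletion (fun x y => Q x y) ι := by
  let C : InnerProductSpace.Core ℝ V :=
    { inner := fun x y => Q x y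
      conj_inner_symm := fun x y => hsymm y x
      re_inner_nonneg := fun x => by
        rcases eq_or_ne x 0 with rfl | h
        · simp
        · exact (hpos x h).le
      add_left := fun x y z => by simp
      smul_left := fun x y r => by simp
      definite := fun x h => by
        by_contra hx
        exact (hpos x hx).ne' h }
  refine ⟨UniformSpace.Completion (PreHilbert C), inferInstance, inferInstance,
    (UniformSpace.Completion.toComplₗᵢ (𝕜 := ℝ) (E := PreHilbert C)).toLinearMap.comp
      (PreHilbert.of C), inferInstance, ?_, fun x y => ?_⟩
  · exact UniformSpace.Completion.denseRange_coe (α := PreHilbert C)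
  · exact UniformSpace.Completion.inner_coe (𝕜 := ℝ) (PreHilbert.of C x) (PreHilbert.of C y)

namespace IsHilbertCompletion

variable {V : Type u} [AddCommGroup V] [Module ℝ V]
  {H : Type v} [NormedAddCommGroup H] [InnerProductSpace ℝ H] {Q : V → V → ℝ} {ι : V →ₗ[ℝ] H}

theorem norm_sq (h : IsHilbertCompletion Q ι) (x : V) : ‖ι x‖ ^ 2 = Q x x := by
  rw [← h.inner_eq, real_inner_self_eq_norm_sq]

theorem ext_inner (h : IsHilbertCompletion Q ι) {a b : H}
    (hab : ∀ y, inner ℝ a (ι y) = inner ℝ b (ι y)) : a = b := by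
  refine ext_inner_right ℝ fun w => ?_
  refine congrFun (h.dense.equalizer (by fun_prop) (by fun_prop) (funext hab)) w

/-- By density the estimate extends to all of `H`; testing it on `a` itself gives `‖a‖² ≤ M ‖a‖`. -/
theorem norm_le (h : IsHilbertCompletion Q ι) {a : H} {M : ℝ} (hM : 0 ≤ M)
    (hab : ∀ y, inner ℝ a (ι y) ≤ M * ‖ι y‖) : ‖a‖ ≤ M := by
  have key : ∀ w : H, inner ℝ a w ≤ M * ‖w‖ := fun w =>
    h.dense.induction_on (p := fun w => inner ℝ a w ≤ M * ‖w‖) w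
      (isClosed_le (by fun_prop) (by fun_prop)) hab
  have := key a
  rw [real_inner_self_eq_norm_sq] at this
  by_contra! hlt
  nlinarith [norm_nonneg a]

/-- The bound makes `f` factor through a continuous functional on the range of `ι`, which
Hahn–Banach extends to `H`, where Riesz applies. -/
theorem exists_riesz (h : IsHilbertCompletion Q ι) (f : V →ₗ[ℝ] ℝ) {M : ℝ}
    (hf : ∀ y, |f y| ≤ M * ‖ι y‖) : ∃ a : H, ∀ y, inner ℝ a (ι y) = f y := by
  have := h.complete
  have hker : LinearMap.ker ι ≤ LinearMap.ker f := fun y hy => by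
    have h0 := hf y
    rw [LinearMap.mem_ker.1 hy, norm_zero, mul_zero] at h0
    exact abs_nonpos_iff.1 h0
  let g₀ : LinearMap.range ι →ₗ[ℝ] ℝ :=
    ((LinearMap.ker ι).liftQ f hker).comp ι.quotKerEquivRange.symm.toLinearMap
  have hg₀ : ∀ y, g₀ ⟨ι y, LinearMap.mem_range_self ι y⟩ = f y := fun y => by
    have : ι.quotKerEquivRange.symm ⟨ι y, LinearMap.mem_range_self ι y⟩ =
        (LinearMap.ker ι).mkQ y := ι.quotKerEquivRange_symm_apply_image y _
    simp only [g₀, LinearMap.comp_apply, LinearEquiv.coe_coe, this]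
    simp
  let g : StrongDual ℝ (LinearMap.range ι) := g₀.mkContinuous M (by
    rintro ⟨_, y, rfl⟩
    rw [hg₀]
    exact hf y)
  obtain ⟨F, hF, -⟩ := exists_extension_norm_eq _ g
  refine ⟨(InnerProductSpace.toDual ℝ H).symm F, fun y => ?_⟩
  rw [InnerProductSpace.toDual_symm_apply, ← hg₀ y]
  exact hF ⟨ι y, LinearMap.mem_range_self ι y⟩

end IsHilbertCompletion

/-! ### Quadratic functions on the line that are bounded below -/

theorem quadratic_leading_nonneg {a b k : ℝ} (h : ∀ x : ℝ, 0 ≤ a * (x * x) + b * x + k) :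
    0 ≤ a := by
  by_contra! ha
  have hk := h 0
  -- Adding the inequalities at `x` and `-x` removes the linear term. This `x` is at least `1` and
  -- satisfies `-a x = k + 1 - a`, so `-a x² > k`.
  set x : ℝ := (k + 1) / (-a) + 1
  have h1 := h x
  have h2 := h (-x)
  have hx : -a * x = k + 1 + -a := by
    simp only [x]
    field_simp [ha.ne]
    ring
  have h3 : 1 ≤ x := by
    have : 0 ≤ (k + 1) / (-a) := div_nonneg (by linarith) (by linarith)
    simp only [x]; linarith
  nlinarith

theorem quadratic_linear_sq_le {a b k : ℝ} (h : ∀ x : ℝ, 0 ≤ a * (x * x) + b * x + k) :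
    b ^ 2 ≤ 4 * a * k := by
  have := discrim_le_zero h
  unfold discrim at this
  linarith

/-! ### One-parameter groups -/

namespace OscillatorData

variable {V : Type u} [AddCommGroup V] [Module ℝ V] [TopologicalSpace V]

theorem γ_neg_apply (S : OscillatorData V) (t : ℝ) (v : V) : S.γ (-t) (S.γ t v) = v := by
  rw [← ContinuousLinearMap.comp_apply, ← S.γ_add, neg_add_cancel, S.γ_zero]
  rfl

theorem γ_apply_neg (S : OscillatorData V) (t : ℝ) (v : V) : S.γ t (S.γ (-t) v) = v := by
  rw [← ContinuousLinearMap.comp_apply, ← S.γ_add, add_neg_cancel, S.γ_zero]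
  rfl

variable [IsTopologicalAddGroup V] [ContinuousSMul ℝ V] [T2Space V]

theorem D_γ (S : OscillatorData V) (t : ℝ) (v : V) : S.D (S.γ t v) = S.γ t (S.D v) := by
  refine tendsto_nhds_unique (S.tendsto_D (S.γ t v))
    ((((S.γ t).continuous.tendsto _).comp (S.tendsto_D v)).congr fun s => ?_)
  simp only [Function.comp_apply, map_smul, map_sub, ← ContinuousLinearMap.comp_apply, ← S.γ_add]
  rw [add_comm]

theorem hasDerivAt_functional_γ (S : OscillatorData V) (α : V →L[ℝ] ℝ) (v : V) (t : ℝ) :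
    HasDerivAt (fun s => α (S.γ s v)) (α (S.D (S.γ t v))) t := by
  rw [hasDerivAt_iff_tendsto_slope_zero]
  refine ((α.continuous.tendsto _).comp (S.tendsto_D (S.γ t v))).congr fun s => ?_
  simp only [Function.comp_apply, map_smul, map_sub, ← ContinuousLinearMap.comp_apply]
  rw [add_comm t s, S.γ_add]

theorem functional_γ_eq (S : OscillatorData V) (α : V →L[ℝ] ℝ) (h : ∀ v, α (S.D v) = 0)
    (t : ℝ) (v : V) : α (S.γ t v) = α v := by
  have hd := S.hasDerivAt_functional_γ α v
  have := is_const_of_deriv_eq_zero (fun s => (hd s).differentiableAt)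
    (fun s => by rw [(hd s).deriv, h]) t 0
  simpa [S.γ_zero] using this

/-! ### Coadjoint orbits -/

theorem exists_functional_components (S : OscillatorData V) (l : S.toHeis.Alg →L[ℝ] ℝ) :
    ∃ (c : ℝ) (α : V →L[ℝ] ℝ) (τ : ℝ), ∀ (z : ℝ) (v : V) (t : ℝ),
      l ((z, v, t) : ℝ × V × ℝ) = c * z + α v + τ * t := by
  let l' : (ℝ × V × ℝ) →L[ℝ] ℝ := l
  refine ⟨l' (1, 0, 0), l'.comp ((ContinuousLinearMap.inr ℝ ℝ (V × ℝ)).comp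
    (ContinuousLinearMap.inl ℝ V ℝ)), l' (0, 0, 1), fun z v t => ?_⟩
  have h : ((z, v, t) : ℝ × V × ℝ) = z • (1, 0, 0) + (0, v, 0) + t • (0, 0, 1) := by simp
  change l' (z, v, t) = _
  rw [h, map_add, map_add, map_smul, map_smul]
  simp [mul_comm]

theorem mem_coadjointOrbit (S : OscillatorData V) (l : S.toHeis.Alg →L[ℝ] ℝ) (g : S.Grp) :
    l.comp (S.Ad g) ∈ S.coadjointOrbit l :=
  ⟨g⁻¹, by simp only [coAd, inv_inv]⟩

theorem Ad_apply (S : OscillatorData V) (z : ℝ) (v : V) (t z' : ℝ) (v' : V) (t' : ℝ) :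
    S.Ad ((z, v, t) : ℝ × V × ℝ) ((z', v', t') : ℝ × V × ℝ) =
      ((z' + S.ω v (S.γ t v') + t' / 2 * S.ω (S.D v) v, S.γ t v' - t' • S.D v, t') :
        ℝ × V × ℝ) := rfl

theorem _root_.neg_le_of_mem_of_supportFunctional_le {X : Type u} [AddCommGroup X] [Module ℝ X]
    [TopologicalSpace X] {E : Set (X →L[ℝ] ℝ)} {x : X} {C : ℝ}
    (h : supportFunctional E x ≤ (C : EReal)) {l : X →L[ℝ] ℝ} (hl : l ∈ E) : -C ≤ l x := by
  have h1 : ((l (-x) : ℝ) : EReal) ≤ C :=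
    (le_iSup₂ (f := fun (α : X →L[ℝ] ℝ) (_ : α ∈ E) => ((α (-x) : ℝ) : EReal)) l hl).trans h
  rw [EReal.coe_le_coe_iff, map_neg] at h1
  linarith

/-- Semi-equicontinuity of an orbit, evaluated at points with a common non-zero `t`. -/
theorem exists_orbit_bound (S : OscillatorData V) {l : S.toHeis.Alg →L[ℝ] ℝ} {c : ℝ}
    {α : V →L[ℝ] ℝ} {τ : ℝ}
    (hl : ∀ (z : ℝ) (v : V) (t : ℝ), l ((z, v, t) : ℝ × V × ℝ) = c * z + α v + τ * t)
    (h : IsSemiEquicontinuous (S.coadjointOrbit l)) :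
    ∃ t₁ : ℝ, t₁ ≠ 0 ∧ ∃ K : ℝ, ∃ v₀ : V, ∃ U ∈ 𝓝 v₀, ∀ u ∈ U, ∀ v,
      0 ≤ c * t₁ / 2 * S.ω (S.D v) v + (c * S.ω v u - t₁ * α (S.D v)) + K := by
  obtain ⟨⟨z₀, v₀, t₀⟩, N, hN, C, hC⟩ := h
  obtain ⟨A, hA, B, hB, hAB⟩ := mem_nhds_prod_iff.1 hN
  obtain ⟨U, hU, T, hT, hUT⟩ := mem_nhds_prod_iff.1 hB
  -- The base point may have `t₀ = 0`, where the quadratic term disappears; a nearby non-zero `t₁`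
  -- is still inside the neighborhood.
  obtain ⟨t₁, ht₁, ht₁'⟩ := (dense_compl_singleton (0 : ℝ)).inter_nhds_nonempty hT
  -- Shrinking the neighborhood bounds the term `α u`, so the constant `K` can be chosen
  -- independently of `u`.
  have hU' : {u : V | α u < α v₀ + 1} ∈ 𝓝 v₀ :=
    (isOpen_lt (by fun_prop) (by fun_prop)).mem_nhds (by simp)
  refine ⟨t₁, ‹_›, C + c * z₀ + (α v₀ + 1) + τ * t₁, v₀, _, inter_mem hU hU', ?_⟩
  rintro u ⟨hu, hu'⟩ v
  have hmem : ((z₀, u, t₁) : ℝ × V × ℝ) ∈ N :=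
    hAB ⟨mem_of_mem_nhds hA, hUT ⟨hu, ‹_›⟩⟩
  have h1 : -C ≤ l (S.Ad ((0, v, 0) : ℝ × V × ℝ) ((z₀, u, t₁) : ℝ × V × ℝ)) :=
    neg_le_of_mem_of_supportFunctional_le (hC _ hmem).2 (S.mem_coadjointOrbit l _)
  rw [Ad_apply, hl] at h1
  simp only [S.γ_zero, ContinuousLinearMap.id_apply, map_sub, map_smul, smul_eq_mul] at h1
  have hu'' : α u < α v₀ + 1 := hu'
  nlinarith

/-- Restricted to each line `ℝv`, the hypothesis is a nonnegative real quadratic polynomial. Its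
leading coefficient gives the sign of `ω(Dv,v)`, its discriminant the estimate of the linear part.
-/
theorem exists_pos_and_bound (S : OscillatorData V) {t₁ c K : ℝ} (ht₁ : t₁ ≠ 0) (hc : c ≠ 0)
    {α : V →L[ℝ] ℝ} {v₀ : V} {U : Set V} (hU : U ∈ 𝓝 v₀)
    (h : ∀ u ∈ U, ∀ v,
      0 ≤ c * t₁ / 2 * S.ω (S.D v) v + (c * S.ω v u - t₁ * α (S.D v)) + K) :
    ∃ ε : ℝ, (ε = 1 ∨ ε = -1) ∧ (∀ x, x ≠ 0 → 0 < S.ω (ε • S.D x) x) ∧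
      ∃ M : ℝ, ∃ N ∈ 𝓝 (0 : V), ∀ u ∈ N, ∀ v,
        |S.ω u v| ≤ M * √(S.ω (ε • S.D v) v) := by
  have hquad : ∀ u ∈ U, ∀ v, ∀ x : ℝ, 0 ≤ c * t₁ / 2 * S.ω (S.D v) v * (x * x) +
      (c * S.ω v u - t₁ * α (S.D v)) * x + K := fun u hu v x => by
    have := h u hu (x • v)
    simp only [map_smul, LinearMap.smul_apply, smul_eq_mul] at this
    linarith
  have hK : 0 ≤ K := by simpa using hquad v₀ (mem_of_mem_nhds hU) 0 0
  obtain ⟨ε, hε, m, hm, hmε⟩ : ∃ ε : ℝ, (ε = 1 ∨ ε = -1) ∧ ∃ m : ℝ, 0 < m ∧ c * t₁ = m * ε := by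
    rcases lt_or_gt_of_ne (mul_ne_zero hc ht₁) with hneg | hpos
    · exact ⟨-1, Or.inr rfl, -(c * t₁), by linarith, by ring⟩
    · exact ⟨1, Or.inl rfl, c * t₁, hpos, by ring⟩
  have hQ : ∀ v, c * t₁ / 2 * S.ω (S.D v) v = m / 2 * S.ω (ε • S.D v) v := fun v => by
    rw [hmε, map_smul, LinearMap.smul_apply, smul_eq_mul]
    ring
  have hnonneg : ∀ v, 0 ≤ S.ω (ε • S.D v) v := fun v => by
    have := quadratic_leading_nonneg (hquad v₀ (mem_of_mem_nhds hU) v)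
    rw [hQ] at this
    exact nonneg_of_mul_nonneg_right this (by positivity)
  have hsq : ∀ u ∈ U, ∀ v, |c * S.ω v u - t₁ * α (S.D v)| ≤
      √(2 * m * K) * √(S.ω (ε • S.D v) v) := fun u hu v => by
    have := quadratic_linear_sq_le (hquad u hu v)
    rw [hQ] at this
    rw [← Real.sqrt_mul (by positivity)]
    exact Real.abs_le_sqrt (by linarith)
  have hN : (fun u => v₀ + u) ⁻¹' U ∈ 𝓝 (0 : V) :=
    (by fun_prop : Continuous fun u => v₀ + u).continuousAt.preimage_mem_nhds (by simpa using hU)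
  have hbound : ∀ u ∈ (fun u => v₀ + u) ⁻¹' U, ∀ v,
      |S.ω u v| ≤ 2 * √(2 * m * K) / |c| * √(S.ω (ε • S.D v) v) := fun u hu v => by
    have h1 := hsq _ hu v
    have h2 := hsq _ (mem_of_mem_nhds hU) v
    -- The difference of the linear parts at `v₀ + u` and `v₀` eliminates `α`, at the price of the
    -- factor `2` in the bound.
    have h3 : c * S.ω v u = (c * S.ω v (v₀ + u) - t₁ * α (S.D v)) -
        (c * S.ω v v₀ - t₁ * α (S.D v)) := by rw [map_add]; ring
    have h4 : |c| * |S.ω v u| ≤ 2 * √(2 * m * K) * √(S.ω (ε • S.D v) v) := by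
      rw [← abs_mul, h3]
      refine (abs_sub _ _).trans ?_
      linarith
    rw [S.swap, abs_neg, div_mul_eq_mul_div, le_div_iff₀ (abs_pos.2 hc)]
    linarith
  refine ⟨ε, hε, fun x hx => (hnonneg x).lt_of_ne fun h0 => hx ?_, _, _, hN, hbound⟩
  -- If `Q(x,x) = 0`, the bound forces `ω(·,x)` to vanish on a neighborhood of `0`, which absorbs
  -- every `y`.
  refine S.nondegenerate x fun y => ?_
  have habs : Absorbent ℝ ((fun u => v₀ + u) ⁻¹' U) := absorbent_nhds_zero hN
  obtain ⟨r, hr, hy⟩ := (habs.eventually_nhdsNE_zero y).and self_mem_nhdsWithin |>.exists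
  have := hbound _ hr x
  rw [← h0, Real.sqrt_zero, mul_zero, map_smul, LinearMap.smul_apply, smul_eq_mul] at this
  have h5 := (mul_eq_zero.1 (abs_nonpos_iff.1 this)).resolve_left hy
  rw [S.swap, h5, neg_zero]

/-- With `c = 0` the orbit bound is affine in `v`, which forces `α ∘ D = 0`. Then `α` is constant
along the trajectories of `γ`, and no group element moves the functional. -/
theorem central_component_ne_zero (S : OscillatorData V) {l : S.toHeis.Alg →L[ℝ] ℝ} {c : ℝ}
    {α : V →L[ℝ] ℝ} {τ : ℝ}
    (hl : ∀ (z : ℝ) (v : V) (t : ℝ), l ((z, v, t) : ℝ × V × ℝ) = c * z + α v + τ * t)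
    (hne : S.coadjointOrbit l ≠ {l}) (h : IsSemiEquicontinuous (S.coadjointOrbit l)) : c ≠ 0 := by
  rintro rfl
  obtain ⟨t₁, ht₁, K, v₀, U, hU, hK⟩ := S.exists_orbit_bound hl h
  have hD : ∀ v, α (S.D v) = 0 := fun v => by
    have h1 := quadratic_linear_sq_le (a := 0) (b := -(t₁ * α (S.D v))) (k := K) fun x => by
      have := hK v₀ (mem_of_mem_nhds hU) (x • v)
      simp only [map_smul, smul_eq_mul] at this
      linarith
    have h2 : t₁ * α (S.D v) = 0 := by
      rw [neg_sq, mul_zero, zero_mul] at h1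
      exact pow_eq_zero_iff two_ne_zero |>.1 (le_antisymm h1 (sq_nonneg _))
    exact (mul_eq_zero.1 h2).resolve_left ht₁
  have hfix : ∀ g : S.Grp, S.coAd g l = l := fun g => by
    refine ContinuousLinearMap.ext fun a => ?_
    change l (S.Ad g⁻¹ a) = l a
    obtain ⟨z, v, t⟩ := g⁻¹
    obtain ⟨z', v', t'⟩ := a
    rw [Ad_apply, hl, hl, map_sub, map_smul, hD, S.functional_γ_eq α hD]
    simp
  refine hne (Set.eq_singleton_iff_unique_mem.2 ⟨⟨1, hfix 1⟩, ?_⟩)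
  rintro _ ⟨g, rfl⟩
  exact hfix g

theorem exists_pos_and_bound_of_orbit (S : OscillatorData V)
    (h : S.HasNontrivialSemiEquicontinuousOrbit) :
    ∃ ε : ℝ, (ε = 1 ∨ ε = -1) ∧ (∀ x, x ≠ 0 → 0 < S.ω (ε • S.D x) x) ∧
      ∃ M : ℝ, ∃ N ∈ 𝓝 (0 : V), ∀ u ∈ N, ∀ v,
        |S.ω u v| ≤ M * √(S.ω (ε • S.D v) v) := by
  obtain ⟨l, hne, hl⟩ := h
  obtain ⟨c, α, τ, hc⟩ := S.exists_functional_components l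
  obtain ⟨t₁, ht₁, K, v₀, U, hU, hK⟩ := S.exists_orbit_bound hc hl
  exact S.exists_pos_and_bound ht₁ (S.central_component_ne_zero hc hne hl) hU hK

end OscillatorData

/-! ### The invariant scalar product -/

/-- The bound on `N` reaches every `x` after scaling, which gives the Riesz vectors; its uniformity
over `N` makes the image of `N` bounded, hence the linear map continuous. -/
theorem exists_continuousLinearMap_riesz {V : Type u} [AddCommGroup V] [Module ℝ V]
    [TopologicalSpace V] [IsTopologicalAddGroup V] [ContinuousSMul ℝ V]
    {H : Type v} [NormedAddCommGroup H] [InnerProductSpace ℝ H] {Q : V → V → ℝ} {ι : V →ₗ[ℝ] H}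
    (hι : IsHilbertCompletion Q ι) (ω : V →ₗ[ℝ] V →ₗ[ℝ] ℝ) {M : ℝ} {N : Set V} (hN : N ∈ 𝓝 0)
    (hω : ∀ u ∈ N, ∀ v, |ω u v| ≤ M * ‖ι v‖) :
    ∃ η : V →L[ℝ] H, ∀ x y, inner ℝ (η x) (ι y) = ω x y := by
  have hex : ∀ x, ∃ a : H, ∀ y, inner ℝ a (ι y) = ω x y := fun x => by
    obtain ⟨r, hr, hr0⟩ :=
      ((absorbent_nhds_zero (𝕜 := ℝ) hN).eventually_nhdsNE_zero x).and self_mem_nhdsWithin |>.exists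
    have hr0 : r ≠ 0 := hr0
    obtain ⟨a, ha⟩ := hι.exists_riesz (ω (r • x)) (hω _ hr)
    refine ⟨r⁻¹ • a, fun y => ?_⟩
    rw [real_inner_smul_left, ha, map_smul, LinearMap.smul_apply, smul_eq_mul,
      inv_mul_cancel_left₀ hr0]
  choose f hf using hex
  let η : V →ₗ[ℝ] H :=
    { toFun := f
      map_add' := fun x y => hι.ext_inner fun w => by simp [inner_add_left, hf]
      map_smul' := fun c x => hι.ext_inner fun w => by simp [real_inner_smul_left, hf] }
  have hb : ∃ U ∈ 𝓝 (0 : V), Bornology.IsVonNBounded ℝ (η '' U) := by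
    refine ⟨N, hN, (NormedSpace.isVonNBounded_iff ℝ).2 (isBounded_iff_forall_norm_le.2 ⟨|M|, ?_⟩)⟩
    rintro _ ⟨u, hu, rfl⟩
    refine hι.norm_le (abs_nonneg M) fun y => ?_
    change inner ℝ (f u) (ι y) ≤ _
    rw [hf]
    refine (le_abs_self _).trans ((hω u hu y).trans ?_)
    exact mul_le_mul_of_nonneg_right (le_abs_self M) (norm_nonneg _)
  exact ⟨η.clmOfExistsBoundedImage hb, hf⟩

namespace OscillatorData

variable {V : Type u} [AddCommGroup V] [Module ℝ V] [TopologicalSpace V]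
  [IsTopologicalAddGroup V] [ContinuousSMul ℝ V] [T2Space V]

/-- Since `γ(t)` is symplectic and commutes with `D`, it preserves `Q`. Pairing `η(γ(t)x)` with `y`
is therefore pairing `η x` with `γ(-t)y`, a vector of the same `Q`-norm as `y`. -/
theorem norm_eta_γ_le (S : OscillatorData V) {ε : ℝ}
    {H : Type v} [NormedAddCommGroup H] [InnerProductSpace ℝ H] {ι : V →ₗ[ℝ] H} {η : V →L[ℝ] H}
    (hι : IsHilbertCompletion (fun x y => S.ω (ε • S.D x) y) ι)
    (hη : ∀ x y, inner ℝ (η x) (ι y) = S.ω x y) (t : ℝ) (x : V) : ‖η (S.γ t x)‖ ≤ ‖η x‖ := by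
  refine hι.norm_le (norm_nonneg _) fun y => ?_
  have h1 : ‖ι (S.γ (-t) y)‖ = ‖ι y‖ := by
    rw [← sq_eq_sq₀ (norm_nonneg _) (norm_nonneg _), hι.norm_sq, hι.norm_sq]
    rw [S.D_γ, ← map_smul, S.γ_symplectic]
  rw [hη, ← h1]
  calc S.ω (S.γ t x) y = S.ω (S.γ t x) (S.γ t (S.γ (-t) y)) := by rw [S.γ_apply_neg]
    _ = inner ℝ (η x) (ι (S.γ (-t) y)) := by rw [S.γ_symplectic, hη]
    _ ≤ _ := real_inner_le_norm _ _

theorem inner_eta_γ (S : OscillatorData V) {ε : ℝ}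
    {H : Type v} [NormedAddCommGroup H] [InnerProductSpace ℝ H] {ι : V →ₗ[ℝ] H} {η : V →L[ℝ] H}
    (hι : IsHilbertCompletion (fun x y => S.ω (ε • S.D x) y) ι)
    (hη : ∀ x y, inner ℝ (η x) (ι y) = S.ω x y) (t : ℝ) (x y : V) :
    inner ℝ (η (S.γ t x)) (η (S.γ t y)) = inner ℝ (η x) (η y) := by
  -- The inequality for `-t` supplies the reverse estimate; polarization then passes from norms to
  -- inner products.
  have key : ∀ x, ‖η (S.γ t x)‖ = ‖η x‖ := fun x =>
    (S.norm_eta_γ_le hι hη t x).antisymm <| by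
      simpa [S.γ_neg_apply] using S.norm_eta_γ_le hι hη (-t) (S.γ t x)
  rw [real_inner_eq_norm_add_mul_self_sub_norm_mul_self_sub_norm_mul_self_div_two,
    real_inner_eq_norm_add_mul_self_sub_norm_mul_self_sub_norm_mul_self_div_two,
    ← map_add, ← map_add, ← map_add, key, key, key]

/-- Both sides have the same pairing with the dense range of `ι`, since `ε² = 1`. So `D` inverts `η`
up to sign, which links `κ` back to `ω`. -/
theorem eta_D (S : OscillatorData V) {ε : ℝ} (hε : ε = 1 ∨ ε = -1)
    {H : Type v} [NormedAddCommGroup H] [InnerProductSpace ℝ H] {ι : V →ₗ[ℝ] H} {η : V →L[ℝ] H}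
    (hι : IsHilbertCompletion (fun x y => S.ω (ε • S.D x) y) ι)
    (hη : ∀ x y, inner ℝ (η x) (ι y) = S.ω x y) (x : V) : η (S.D x) = ε • ι x := by
  refine hι.ext_inner fun y => ?_
  rw [hη, real_inner_smul_left, hι.inner_eq, map_smul, LinearMap.smul_apply, smul_eq_mul]
  rcases hε with rfl | rfl <;> ring

theorem inner_eta_D (S : OscillatorData V) {ε : ℝ} (hε : ε = 1 ∨ ε = -1)
    {H : Type v} [NormedAddCommGroup H] [InnerProductSpace ℝ H] {ι : V →ₗ[ℝ] H} {η : V →L[ℝ] H}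
    (hι : IsHilbertCompletion (fun x y => S.ω (ε • S.D x) y) ι)
    (hη : ∀ x y, inner ℝ (η x) (ι y) = S.ω x y) (x y : V) :
    inner ℝ (η (S.D x)) (η y) = -ε * S.ω x y := by
  rw [S.eta_D hε hι hη, real_inner_smul_left, real_inner_comm, hη, S.swap]
  ring

/-- The double extension with `κ(x,y) = ⟨η x, η y⟩`. -/
noncomputable def doubleExt (S : OscillatorData V) [Nontrivial V] {ε : ℝ} (hε : ε = 1 ∨ ε = -1)
    (hpos : ∀ x, x ≠ 0 → 0 < S.ω (ε • S.D x) x)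
    {H : Type v} [NormedAddCommGroup H] [InnerProductSpace ℝ H] {ι : V →ₗ[ℝ] H} {η : V →L[ℝ] H}
    (hι : IsHilbertCompletion (fun x y => S.ω (ε • S.D x) y) ι)
    (hη : ∀ x y, inner ℝ (η x) (ι y) = S.ω x y) : DoubleExtData V where
  κ := (innerₗ H).compl₁₂ η.toLinearMap η.toLinearMap
  continuous_κ := by
    change Continuous fun p : V × V => inner ℝ (η p.1) (η p.2)
    fun_prop
  symm x y := real_inner_comm _ _
  pos_def x hx := by
    change 0 < inner ℝ (η x) (η x)
    rw [real_inner_self_eq_norm_sq]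
    -- Definiteness of `κ` is injectivity of `η`, inherited from non-degeneracy of `ω`.
    have : η x ≠ 0 := fun h0 => hx <| S.nondegenerate x fun y => by
      rw [← hη, h0, inner_zero_left]
    positivity
  D := S.D
  skew x y := by
    change inner ℝ (η (S.D x)) (η y) = -inner ℝ (η x) (η (S.D y))
    rw [S.inner_eta_D hε hι hη, real_inner_comm, S.inner_eta_D hε hι hη, S.swap]
    ring
  D_ne_zero h := by
    obtain ⟨x, hx⟩ := exists_ne (0 : V)
    have := hpos x hx
    simp [h] at this

/-- The two cocycles differ by the factor `r`, which is absorbed by multiplying the central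
coordinate by `r`. -/
theorem topLieIso_of_smul (S : OscillatorData V) (T : DoubleExtData V) (hD : T.D = S.D) {r : ℝ}
    (hr : r ≠ 0) (h : ∀ x y, T.κ (S.D x) y = r * S.ω x y) : S.toHeis.TopLieIso T.toHeis := by
  let f : S.toHeis.Alg ≃ₗ⁅ℝ⁆ T.toHeis.Alg :=
    { toFun := fun a => ((r * a.1, a.2.1, a.2.2) : ℝ × V × ℝ)
      invFun := fun a => ((r⁻¹ * a.1, a.2.1, a.2.2) : ℝ × V × ℝ)
      left_inv := fun a => Prod.ext (inv_mul_cancel_left₀ hr _) rfl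
      right_inv := fun a => Prod.ext (mul_inv_cancel_left₀ hr _) rfl
      map_add' := fun a b => Prod.ext (mul_add r a.1 b.1) rfl
      map_smul' := fun c a => Prod.ext (mul_left_comm r c a.1) rfl
      map_lie' := fun {a b} => by
        refine Prod.ext ?_ (Prod.ext ?_ rfl)
        · change r * S.ω a.2.1 b.2.1 = T.κ (T.D a.2.1) b.2.1
          rw [hD, h]
        · change a.2.2 • S.D b.2.1 - b.2.2 • S.D a.2.1 = a.2.2 • T.D b.2.1 - b.2.2 • T.D a.2.1
          rw [hD] }
  refine ⟨f, ?_, ?_⟩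
  · change Continuous fun a : ℝ × V × ℝ => ((r * a.1, a.2.1, a.2.2) : ℝ × V × ℝ)
    fun_prop
  · change Continuous fun a : ℝ × V × ℝ => ((r⁻¹ * a.1, a.2.1, a.2.2) : ℝ × V × ℝ)
    fun_prop

theorem exists_doubleExt_of_orbit [Nontrivial V] (S : OscillatorData V)
    (h : S.HasNontrivialSemiEquicontinuousOrbit) :
    ∃ ε : ℝ, (ε = 1 ∨ ε = -1) ∧ (∀ x, x ≠ 0 → 0 < S.ω (ε • S.D x) x) ∧
      ∃ (H : Type u) (_ : NormedAddCommGroup H) (_ : InnerProductSpace ℝ H)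
        (ι : V →ₗ[ℝ] H) (η : V →L[ℝ] H) (T : DoubleExtData V),
        IsHilbertCompletion (fun x y => S.ω (ε • S.D x) y) ι ∧
        (∀ x y, inner ℝ (η x) (ι y) = S.ω x y) ∧
        (∀ x y, T.κ x y = inner ℝ (η x) (η y)) ∧
        T.D = S.D ∧
        (∀ t x y, T.κ (S.γ t x) (S.γ t y) = T.κ x y) ∧
        S.toHeis.TopLieIso T.toHeis := by
  obtain ⟨ε, hε, hpos, M, N, hN, hM⟩ := S.exists_pos_and_bound_of_orbit h
  obtain ⟨H, _, _, ι, hι⟩ := exists_isHilbertCompletion (S.ω.comp (ε • S.D.toLinearMap))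
    (fun x y => by
      have h1 := S.D_skew x y
      have h2 := S.swap x (S.D y)
      simp only [LinearMap.comp_apply, LinearMap.smul_apply, map_smul, smul_eq_mul,
        ContinuousLinearMap.coe_coe]
      linear_combination ε * h1 - ε * h2) hpos
  obtain ⟨η, hη⟩ := exists_continuousLinearMap_riesz hι S.ω hN (M := M) fun u hu v => by
    refine (hM u hu v).trans_eq ?_
    rw [← Real.sqrt_sq (norm_nonneg (ι v)), hι.norm_sq]
    rfl
  refine ⟨ε, hε, hpos, H, _, _, ι, η, S.doubleExt hε hpos hι hη, hι, hη, fun _ _ => rfl, rfl,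
    S.inner_eta_γ hι hη, S.topLieIso_of_smul _ rfl (r := -ε) ?_ (S.inner_eta_D hε hι hη)⟩
  rcases hε with rfl | rfl <;> norm_num

end OscillatorData

/-- The element `(z, v, t)` of the Lie algebra. -/
def HeisDerivation.triple {V : Type u} [AddCommGroup V] [Module ℝ V] [TopologicalSpace V]
    (S : HeisDerivation V) (z : ℝ) (v : V) (t : ℝ) : S.Alg := ((z, v, t) : ℝ × V × ℝ)

/-! ### The invariant Lorentzian form on a double extension -/

namespace DoubleExtData

variable {W : Type u} [AddCommGroup W] [Module ℝ W] [TopologicalSpace W]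

/-- The invariant symmetric form `B((z,w,t),(z',w',t')) = z t' + t z' + κ(w,w')`. -/
def form (T : DoubleExtData W) : T.toHeis.Alg →ₗ[ℝ] T.toHeis.Alg →ₗ[ℝ] ℝ :=
  LinearMap.mk₂ ℝ (fun a b => a.1 * b.2.2 + a.2.2 * b.1 + T.κ a.2.1 b.2.1)
    (fun a a' b => by
      change (a.1 + a'.1) * b.2.2 + (a.2.2 + a'.2.2) * b.1 + T.κ (a.2.1 + a'.2.1) b.2.1 = _
      rw [map_add, LinearMap.add_apply]; ring)
    (fun r a b => by
      change (r * a.1) * b.2.2 + (r * a.2.2) * b.1 + T.κ (r • a.2.1) b.2.1 = _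
      rw [map_smul, LinearMap.smul_apply, smul_eq_mul, smul_eq_mul]; ring)
    (fun a b b' => by
      change a.1 * (b.2.2 + b'.2.2) + a.2.2 * (b.1 + b'.1) + T.κ a.2.1 (b.2.1 + b'.2.1) = _
      rw [map_add]; ring)
    (fun r a b => by
      change a.1 * (r * b.2.2) + a.2.2 * (r * b.1) + T.κ a.2.1 (r • b.2.1) = _
      rw [map_smul, smul_eq_mul, smul_eq_mul]; ring)

theorem form_apply (T : DoubleExtData W) (a b : T.toHeis.Alg) :
    T.form a b = a.1 * b.2.2 + a.2.2 * b.1 + T.κ a.2.1 b.2.1 := rfl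

theorem form_triple (T : DoubleExtData W) (z : ℝ) (w : W) (t : ℝ) (b : T.toHeis.Alg) :
    T.form (T.toHeis.triple z w t) b = z * b.2.2 + t * b.1 + T.κ w b.2.1 := rfl

theorem continuous_form (T : DoubleExtData W) :
    Continuous fun p : T.toHeis.Alg × T.toHeis.Alg => T.form p.1 p.2 := by
  change Continuous fun p : (ℝ × W × ℝ) × (ℝ × W × ℝ) =>
    p.1.1 * p.2.2.2 + p.1.2.2 * p.2.1 + T.κ p.1.2.1 p.2.2.1
  have := T.continuous_κ.comp
    (by fun_prop : Continuous fun p : (ℝ × W × ℝ) × (ℝ × W × ℝ) => (p.1.2.1, p.2.2.1))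
  exact Continuous.add (by fun_prop) this

/-- The central terms `κ(Dw,·)` of the bracket, paired with `t`-coordinates, cancel the `Dw` terms
of the `W`-component; the terms carrying the `t` of `x` cancel by skewness of `D`. -/
theorem form_lie (T : DoubleExtData W) (x a b : T.toHeis.Alg) :
    T.form ⁅x, a⁆ b + T.form a ⁅x, b⁆ = 0 := by
  obtain ⟨z, w, t⟩ := x
  obtain ⟨z₁, w₁, t₁⟩ := a
  obtain ⟨z₂, w₂, t₂⟩ := b
  change T.κ (T.D w) w₁ * t₂ + 0 * z₂ + T.κ (t • T.D w₁ - t₁ • T.D w) w₂ +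
    (z₁ * 0 + t₁ * T.κ (T.D w) w₂ + T.κ w₁ (t • T.D w₂ - t₂ • T.D w)) = 0
  simp only [map_sub, map_smul, LinearMap.sub_apply, LinearMap.smul_apply, smul_eq_mul]
  linear_combination t * T.skew w₁ w₂ - t₂ * T.symm w₁ (T.D w)

theorem eq_zero_of_form_eq_zero (T : DoubleExtData W) {a : T.toHeis.Alg}
    (h : ∀ b, T.form a b = 0) : a = 0 := by
  obtain ⟨z, w, t⟩ := a
  have hz : z * 1 + t * 0 + T.κ w 0 = 0 := h ((0, 0, 1) : ℝ × W × ℝ)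
  have ht : z * 0 + t * 1 + T.κ w 0 = 0 := h ((1, 0, 0) : ℝ × W × ℝ)
  have hw : z * 0 + t * 0 + T.κ w w = 0 := h ((0, w, 0) : ℝ × W × ℝ)
  have hw' : w = 0 := by
    by_contra hne
    have := T.pos_def w hne
    linarith
  simp only [map_zero, mul_one, mul_zero, add_zero, zero_add] at hz ht
  rw [hz, hw', ht]
  rfl

theorem lie_of_ne_zero (T : DoubleExtData W) :
    ∃ x : T.toHeis.Alg, ⁅x, T.toHeis.triple 0 0 1⁆ ≠ 0 := by
  by_contra! h
  refine T.D_ne_zero (ContinuousLinearMap.ext fun w => ?_)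
  have h1 := congrArg (fun a : ℝ × W × ℝ => a.2.1) (h (T.toHeis.triple 0 w 0))
  change (0 : ℝ) • T.D 0 - (1 : ℝ) • T.D w = 0 at h1
  simpa using h1

theorem lie_central (T : DoubleExtData W) (a : T.toHeis.Alg) :
    ⁅T.toHeis.triple 1 0 0, a⁆ = 0 := by
  refine Prod.ext ?_ (Prod.ext ?_ rfl)
  · change T.κ (T.D 0) a.2.1 = 0
    simp
  · change (0 : ℝ) • T.D a.2.1 - a.2.2 • T.D 0 = 0
    simp

end DoubleExtData

/-! ### Invariance under the adjoint action -/

namespace OscillatorData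

variable {V : Type u} [AddCommGroup V] [Module ℝ V] [TopologicalSpace V]
  [IsTopologicalAddGroup V] [ContinuousSMul ℝ V] [T2Space V]

/-- The element `(0, v, 0)`. -/
def vec (S : OscillatorData V) (v : V) : S.toHeis.Alg := ((0, v, 0) : ℝ × V × ℝ)

/-- The group element `(0, v, 0)`. -/
def transl (S : OscillatorData V) (v : V) : S.Grp := ((0, v, 0) : ℝ × V × ℝ)

/-- The group element `(0, 0, t)`. -/
def rot (S : OscillatorData V) (t : ℝ) : S.Grp := ((0, 0, t) : ℝ × V × ℝ)

theorem Ad_eq_transl_rot (S : OscillatorData V) (g : S.Grp) (a : S.toHeis.Alg) :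
    S.Ad g a = S.Ad (S.transl g.2.1) (S.Ad (S.rot g.2.2) a) := by
  obtain ⟨z, v, t⟩ := g
  obtain ⟨z', v', t'⟩ := a
  simp [transl, rot, Ad_apply, S.γ_zero]
  rfl

/-- This is the exponential series of `ad (0,v,0)`, which stops after the quadratic term because the
cube of that operator is zero. -/
theorem Ad_transl (S : OscillatorData V) (v : V) (a : S.toHeis.Alg) :
    S.Ad (S.transl v) a = a + ⁅S.vec v, a⁆ + (1 / 2 : ℝ) • ⁅S.vec v, ⁅S.vec v, a⁆⁆ := by
  obtain ⟨z, w, t⟩ := a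
  refine Prod.ext ?_ (Prod.ext ?_ ?_)
  · change z + S.ω v (S.γ 0 w) + t / 2 * S.ω (S.D v) v =
      z + S.ω v w + 1 / 2 * S.ω v ((0 : ℝ) • S.D w - t • S.D v)
    rw [S.γ_zero, S.swap (S.D v)]
    simp
    ring
  · change S.γ 0 w - t • S.D v = w + ((0 : ℝ) • S.D w - t • S.D v) +
      (1 / 2 : ℝ) • ((0 : ℝ) • S.D ((0 : ℝ) • S.D w - t • S.D v) - (0 : ℝ) • S.D v)
    rw [S.γ_zero]
    simp [sub_eq_add_neg]
  · change t = t + 0 + 1 / 2 * 0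
    ring

theorem lie_vec_cube (S : OscillatorData V) (v : V) (a : S.toHeis.Alg) :
    ⁅S.vec v, ⁅S.vec v, ⁅S.vec v, a⁆⁆⁆ = 0 := by
  obtain ⟨z, w, t⟩ := a
  refine Prod.ext ?_ (Prod.ext ?_ rfl)
  · change S.ω v ((0 : ℝ) • S.D ((0 : ℝ) • S.D w - t • S.D v) - (0 : ℝ) • S.D v) = 0
    simp
  · change (0 : ℝ) • S.D _ - (0 : ℝ) • S.D v = 0
    simp

variable (S : OscillatorData V) (B : S.toHeis.Alg →ₗ[ℝ] S.toHeis.Alg →ₗ[ℝ] ℝ)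

theorem invariant_transl (hB : ∀ x a b : S.toHeis.Alg, B ⁅x, a⁆ b + B a ⁅x, b⁆ = 0) (v : V)
    (a b : S.toHeis.Alg) : B (S.Ad (S.transl v) a) (S.Ad (S.transl v) b) = B a b := by
  have h1 := hB (S.vec v) a b
  have h2 := hB (S.vec v) ⁅S.vec v, a⁆ b
  have h3 := hB (S.vec v) a ⁅S.vec v, b⁆
  have h4 := hB (S.vec v) a ⁅S.vec v, ⁅S.vec v, b⁆⁆
  have h5 := hB (S.vec v) ⁅S.vec v, ⁅S.vec v, a⁆⁆ b
  -- In the expanded product, `h1` removes the terms of degree one in `ad (0,v,0)`, `h2` and `h3`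
  -- those of degree two. Nilpotency turns `h4`, `h5` and `h6` into the vanishing of the degree
  -- three and four terms.
  have h6 := hB (S.vec v) ⁅S.vec v, a⁆ ⁅S.vec v, ⁅S.vec v, b⁆⁆
  rw [lie_vec_cube, map_zero] at h4 h6
  rw [lie_vec_cube, map_zero, LinearMap.zero_apply] at h5
  rw [Ad_transl, Ad_transl]
  simp only [map_add, map_smul, LinearMap.add_apply, LinearMap.smul_apply, smul_eq_mul]
  linear_combination h1 + 1 / 2 * h2 + 1 / 2 * h3 + 1 / 2 * h4 + 1 / 2 * h5 + 1 / 4 * h6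

theorem Ad_rot_add (s t : ℝ) (a : S.toHeis.Alg) :
    S.Ad (S.rot (s + t)) a = S.Ad (S.rot s) (S.Ad (S.rot t) a) := by
  obtain ⟨z, v, r⟩ := a
  simp [rot, Ad_apply, S.γ_add]
  rfl

theorem Ad_rot_zero (a : S.toHeis.Alg) : S.Ad (S.rot 0) a = a := by
  obtain ⟨z, v, r⟩ := a
  simp [rot, Ad_apply, S.γ_zero]
  rfl

theorem tendsto_Ad_rot (a : S.toHeis.Alg) :
    Tendsto (fun s : ℝ => S.Ad (S.rot s) a) (𝓝[≠] 0) (𝓝 a) := by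
  obtain ⟨z, v, r⟩ := a
  have h := (tendsto_const_nhds (x := z)).prodMk_nhds
    (((S.tendsto_γ v).mono_left (nhdsWithin_le_nhds (s := {0}ᶜ))).prodMk_nhds
      (tendsto_const_nhds (x := r)))
  refine h.congr fun s => ?_
  simp [rot, Ad_apply]
  rfl

theorem tendsto_Ad_rot_slope (a : S.toHeis.Alg) :
    Tendsto (fun s : ℝ => s⁻¹ • (S.Ad (S.rot s) a - a)) (𝓝[≠] 0)
      (𝓝 ⁅S.toHeis.triple 0 0 1, a⁆) := by
  obtain ⟨z, v, r⟩ := a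
  have h := (tendsto_const_nhds (x := (0 : ℝ))).prodMk_nhds
    ((S.tendsto_D v).prodMk_nhds (tendsto_const_nhds (x := (0 : ℝ))))
  have e : ⁅S.toHeis.triple 0 0 1, S.toHeis.triple z v r⁆ =
      ((0, S.D v, 0) : ℝ × V × ℝ) := by
    change ((S.ω 0 v, (1 : ℝ) • S.D v - r • S.D 0, 0) : ℝ × V × ℝ) = _
    simp
  change Tendsto _ _ (𝓝 ⁅S.toHeis.triple 0 0 1, S.toHeis.triple z v r⁆)
  rw [e]
  refine h.congr fun s => ?_
  refine Prod.ext ?_ (Prod.ext ?_ ?_)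
  · change 0 = s⁻¹ * (z + S.ω 0 (S.γ s v) + r / 2 * S.ω (S.D 0) 0 - z)
    simp
  · change s⁻¹ • (S.γ s v - v) = s⁻¹ • (S.γ s v - r • S.D 0 - v)
    simp
  · change 0 = s⁻¹ * (r - r)
    simp

/-- Infinitesimal invariance under `(0,0,1)` says that `B` has zero derivative along the
one-parameter group of rotations; continuity of `B` justifies the product rule. -/
theorem invariant_rot (hc : Continuous fun p : S.toHeis.Alg × S.toHeis.Alg => B p.1 p.2)
    (hB : ∀ x a b : S.toHeis.Alg, B ⁅x, a⁆ b + B a ⁅x, b⁆ = 0) (t : ℝ) (a b : S.toHeis.Alg) :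
    B (S.Ad (S.rot t) a) (S.Ad (S.rot t) b) = B a b := by
  have hd : ∀ t, HasDerivAt (fun s => B (S.Ad (S.rot s) a) (S.Ad (S.rot s) b)) 0 t := fun t => by
    have h0 := hB (S.toHeis.triple 0 0 1) (S.Ad (S.rot t) a) (S.Ad (S.rot t) b)
    rw [hasDerivAt_iff_tendsto_slope_zero]
    have h1 := (hc.tendsto (_, _)).comp ((S.tendsto_Ad_rot_slope (S.Ad (S.rot t) a)).prodMk_nhds
      (S.tendsto_Ad_rot (S.Ad (S.rot t) b)))
    have h2 := (hc.tendsto (_, _)).comp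
      ((tendsto_const_nhds (x := S.Ad (S.rot t) a)).prodMk_nhds
        (S.tendsto_Ad_rot_slope (S.Ad (S.rot t) b)))
    have h3 := h1.add h2
    rw [h0] at h3
    refine h3.congr fun s => ?_
    simp only [Function.comp_apply, add_comm t s, Ad_rot_add, map_smul, map_sub,
      LinearMap.smul_apply, LinearMap.sub_apply, smul_eq_mul]
    ring
  have := is_const_of_deriv_eq_zero (fun s => (hd s).differentiableAt) (fun s => (hd s).deriv) t 0
  simpa only [Ad_rot_zero] using this

theorem invariant_Ad (hc : Continuous fun p : S.toHeis.Alg × S.toHeis.Alg => B p.1 p.2)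
    (hB : ∀ x a b : S.toHeis.Alg, B ⁅x, a⁆ b + B a ⁅x, b⁆ = 0) (g : S.Grp) (a b : S.toHeis.Alg) :
    B (S.Ad g a) (S.Ad g b) = B a b := by
  rw [Ad_eq_transl_rot, S.Ad_eq_transl_rot g b, S.invariant_transl B hB,
    S.invariant_rot B hc hB]

/-- Non-degeneracy gives a central element the form `(z,0,t)` with `tD = 0`, which kills every
correction term in the formula for `Ad`. -/
theorem Ad_central {c : S.toHeis.Alg} (hc : ∀ a : S.toHeis.Alg, ⁅c, a⁆ = 0) (g : S.Grp) : S.Ad g c = c := by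
  obtain ⟨z, v, t⟩ := c
  obtain ⟨z', v', t'⟩ := g
  have hv : v = 0 := S.nondegenerate v fun y => by
    have := congrArg (fun a : ℝ × V × ℝ => a.1) (hc (S.vec y))
    exact this
  subst hv
  have hD : t • S.D v' = 0 := by
    have := congrArg (fun a : ℝ × V × ℝ => a.2.1) (hc (S.vec v'))
    change t • S.D v' - (0 : ℝ) • S.D 0 = 0 at this
    simpa using this
  have h2 : t / 2 * S.ω (S.D v') v' = 0 := by
    have : S.ω (t • S.D v') v' = 0 := by rw [hD]; simp
    rw [map_smul, LinearMap.smul_apply, smul_eq_mul] at this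
    linarith
  rw [Ad_apply, h2, hD]
  simp
  rfl

theorem central_of_lie_vec {x : S.toHeis.Alg} (h : ∀ v, ⁅S.vec v, x⁆ = 0) (a : S.toHeis.Alg) :
    ⁅a, x⁆ = 0 := by
  obtain ⟨z, w, t⟩ := x
  obtain ⟨z', w', t'⟩ := a
  have hw : w = 0 := S.nondegenerate w fun y => by
    have h1 : S.ω y w = 0 := congrArg (fun a : ℝ × V × ℝ => a.1) (h y)
    rw [S.swap, h1, neg_zero]
  subst hw
  have hD : (0 : ℝ) • S.D 0 - t • S.D w' = 0 := congrArg (fun a : ℝ × V × ℝ => a.2.1) (h w')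
  refine Prod.ext ?_ (Prod.ext ?_ rfl)
  · exact map_zero (S.ω w')
  · change t' • S.D 0 - t • S.D w' = 0
    simpa using hD

/-- A functional fixed by the coadjoint action vanishes on all brackets with `(0, v, 0)`. -/
theorem functional_lie_vec_of_orbit_eq {l : S.toHeis.Alg →L[ℝ] ℝ} (h : S.coadjointOrbit l = {l})
    (v : V) (a : S.toHeis.Alg) : l ⁅S.vec v, a⁆ = 0 := by
  have hfix : ∀ v, l (S.Ad (S.transl v) a) = l a := fun v => by
    have hm := S.mem_coadjointOrbit l (S.transl v)
    rw [h, Set.mem_singleton_iff] at hm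
    exact congrArg (fun m : S.toHeis.Alg →L[ℝ] ℝ => m a) hm
  have h1 := hfix v
  -- Comparing `v` with `-v` isolates the part of `Ad(0,v,0)` that is odd in `v`, namely the
  -- bracket.
  have h2 := hfix (-v)
  have hneg : S.vec (-v) = -S.vec v := by
    change ((0, -v, 0) : ℝ × V × ℝ) = -(0, v, 0)
    simp
  rw [Ad_transl] at h1 h2
  rw [hneg, neg_lie, neg_lie, lie_neg, neg_neg] at h2
  have e : ∀ x y : S.toHeis.Alg, l (x + y) = l x + l y := map_add l
  have e' : ∀ x : S.toHeis.Alg, l (-x) = -l x := fun x => by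
    rw [← neg_one_smul ℝ, map_smul, smul_eq_mul]; ring
  simp only [e, e'] at h1 h2
  linarith

end OscillatorData

/-! ### Semi-equicontinuous orbits from double extensions -/

theorem isSemiEquicontinuous_of_lower_bound {X : Type u} [AddCommGroup X] [Module ℝ X]
    [TopologicalSpace X] {E : Set (X →L[ℝ] ℝ)} (hE : E.Nonempty) {x₀ : X} {U : Set X}
    (hU : U ∈ 𝓝 x₀) {C : ℝ} (h : ∀ l ∈ E, ∀ x ∈ U, -C ≤ l x) : IsSemiEquicontinuous E := by
  obtain ⟨l, hl⟩ := hE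
  -- Finiteness of the support functional from below needs only one member of `E`, locally bounded
  -- by continuity.
  have hl' : {x | l x < l x₀ + 1} ∈ 𝓝 x₀ :=
    l.continuous.continuousAt.preimage_mem_nhds (Iio_mem_nhds (by linarith))
  refine ⟨x₀, _, inter_mem hU hl', max C (l x₀ + 1), fun x hx => ⟨?_, ?_⟩⟩
  · refine le_trans ?_
      (le_iSup₂ (f := fun (α : X →L[ℝ] ℝ) (_ : α ∈ E) => ((α (-x) : ℝ) : EReal)) l hl)
    have h1 : l x < l x₀ + 1 := hx.2
    rw [EReal.coe_le_coe_iff, map_neg]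
    exact neg_le_neg (h1.le.trans (le_max_right _ _))
  · refine iSup₂_le fun α hα => ?_
    rw [EReal.coe_le_coe_iff, map_neg]
    exact (neg_le.1 (h α hα x hx.1)).trans (le_max_left _ _)

theorem OscillatorData.hasOrbit_of_topLieIso {V : Type u} [AddCommGroup V] [Module ℝ V]
    [TopologicalSpace V] [IsTopologicalAddGroup V] [ContinuousSMul ℝ V] [T2Space V]
    (S : OscillatorData V) {W : Type v} [AddCommGroup W] [Module ℝ W] [TopologicalSpace W]
    (T : DoubleExtData W) (h : S.toHeis.TopLieIso T.toHeis) :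
    S.HasNontrivialSemiEquicontinuousOrbit := by
  obtain ⟨e, he, -⟩ := h
  let B : S.toHeis.Alg →ₗ[ℝ] S.toHeis.Alg →ₗ[ℝ] ℝ :=
    T.form.compl₁₂ (e : S.toHeis.Alg →ₗ[ℝ] T.toHeis.Alg) (e : S.toHeis.Alg →ₗ[ℝ] T.toHeis.Alg)
  have hBe : ∀ a b, B a b = T.form (e a) (e b) := fun _ _ => rfl
  have hBc : Continuous fun p : S.toHeis.Alg × S.toHeis.Alg => B p.1 p.2 :=
    T.continuous_form.comp ((he.comp continuous_fst).prodMk (he.comp continuous_snd))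
  have hBi : ∀ x a b : S.toHeis.Alg, B ⁅x, a⁆ b + B a ⁅x, b⁆ = 0 := fun x a b => by
    simp only [hBe, LieEquiv.map_lie]
    exact T.form_lie _ _ _
  let x₀ : S.toHeis.Alg := e.symm (T.toHeis.triple 0 0 1)
  -- The bound is sought around a point with `t = -1`: negative `t` is what makes `-κ(w,w)/(2t)`
  -- nonnegative.
  let y₀ : S.toHeis.Alg := e.symm (T.toHeis.triple 0 0 (-1))
  let c : S.toHeis.Alg := e.symm (T.toHeis.triple 1 0 0)
  have hx₀ : e x₀ = T.toHeis.triple 0 0 1 := e.apply_symm_apply _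
  have hy₀ : e y₀ = T.toHeis.triple 0 0 (-1) := e.apply_symm_apply _
  have hc : e c = T.toHeis.triple 1 0 0 := e.apply_symm_apply _
  have hcentral : ∀ a : S.toHeis.Alg, ⁅c, a⁆ = 0 := fun a => e.injective <| by
    change e ⁅c, a⁆ = e 0
    rw [LieEquiv.map_lie, hc, T.lie_central, map_zero]
  have hBx₀ : ∀ a, B x₀ a = (e a).1 := fun a => by
    rw [hBe, hx₀, T.form_triple]
    simp
  have hBcc : ∀ a, B c a = (e a).2.2 := fun a => by
    rw [hBe, hc, T.form_triple]
    simp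
  let l : S.toHeis.Alg →L[ℝ] ℝ :=
    ⟨B x₀, hBc.comp (continuous_const.prodMk continuous_id)⟩
  have hl : ∀ a, l a = B x₀ a := fun _ => rfl
  refine ⟨l, fun htriv => ?_, ?_⟩
  · obtain ⟨x, hx⟩ := T.lie_of_ne_zero
    -- If the orbit were a point, invariance would make `[(0,v,0), x₀]` orthogonal to everything for
    -- the non-degenerate form. Then `x₀` would be central, against `D' ≠ 0`.
    have hvec : ∀ v, ⁅S.vec v, x₀⁆ = 0 := fun v => e.injective <| by
      rw [map_zero]
      refine T.eq_zero_of_form_eq_zero fun b => ?_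
      have h1 := hBi (S.vec v) x₀ (e.symm b)
      rw [← hl, S.functional_lie_vec_of_orbit_eq htriv, add_zero, hBe, e.apply_symm_apply] at h1
      exact h1
    refine hx ?_
    have h2 := congrArg e (S.central_of_lie_vec hvec (e.symm x))
    rwa [LieEquiv.map_lie, e.apply_symm_apply, hx₀, map_zero] at h2
  · have hq : Continuous fun a => B a a := hBc.comp (continuous_id.prodMk continuous_id)
    have ht : Continuous fun a => B c a := hBc.comp (continuous_const.prodMk continuous_id)
    have hty₀ : B c y₀ = -1 := by rw [hBcc, hy₀]; rfl
    have hqy₀ : B y₀ y₀ = 0 := by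
      rw [hBe, hy₀, T.form_triple]
      change (0 : ℝ) * -1 + -1 * 0 + T.κ 0 0 = 0
      simp
    have h1 : {a | B c a < 0} ∈ 𝓝 y₀ := ht.continuousAt.preimage_mem_nhds
      (Iio_mem_nhds (by rw [hty₀]; norm_num))
    have h2 : {a | -1 < B a a / (2 * B c a)} ∈ 𝓝 y₀ := by
      have hcont : ContinuousAt (fun a => B a a / (2 * B c a)) y₀ :=
        hq.continuousAt.div (ht.continuousAt.const_mul 2) (by rw [hty₀]; norm_num)
      refine hcont.preimage_mem_nhds (Ioi_mem_nhds ?_)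
      rw [hqy₀, zero_div]
      norm_num
    refine isSemiEquicontinuous_of_lower_bound (Set.range_nonempty _) (inter_mem h1 h2) (C := 1) ?_
    rintro _ ⟨g, rfl⟩ a ⟨ha1, ha2⟩
    have ha1 : B c a < 0 := ha1
    have ha2 : -1 < B a a / (2 * B c a) := ha2
    change -1 ≤ l (S.Ad g⁻¹ a)
    generalize g⁻¹ = g'
    have hqa := S.invariant_Ad B hBc hBi g' a a
    have hta := S.invariant_Ad B hBc hBi g' c a
    rw [S.Ad_central hcentral] at hta
    rw [hl, hBx₀]
    rw [hBcc] at hta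
    -- `hqa` now reads `2zt + κ(w,w) = B(a,a)`, where `z` and `w` are coordinates of the moved point
    -- and `t = B(c,a)` has not changed. Dividing by `2t < 0` and dropping `κ(w,w) ≥ 0` gives the
    -- lower bound for `z`.
    rw [hBe, T.form_apply, hta] at hqa
    have hκ : 0 ≤ T.κ (e (S.Ad g' a)).2.1 (e (S.Ad g' a)).2.1 := by
      rcases eq_or_ne (e (S.Ad g' a)).2.1 0 with h0 | h0
      · rw [h0, map_zero]
      · exact (T.pos_def _ h0).le
    refine ha2.le.trans ?_
    rw [div_le_iff_of_neg (by linarith)]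
    linarith

theorem theorem4p2 {V : Type u} [AddCommGroup V] [Module ℝ V] [TopologicalSpace V]
    [IsTopologicalAddGroup V] [ContinuousSMul ℝ V] [LocallyConvexSpace ℝ V] [T2Space V]
    [Nontrivial V] (S : OscillatorData V) :
    -- the characterization
    (S.HasNontrivialSemiEquicontinuousOrbit ↔
      ∃ (W : Type u) (_ : AddCommGroup W) (_ : Module ℝ W) (_ : TopologicalSpace W)
        (_ : IsTopologicalAddGroup W) (_ : ContinuousSMul ℝ W) (_ : LocallyConvexSpace ℝ W)
        (_ : T2Space W) (T : DoubleExtData W), S.toHeis.TopLieIso T.toHeis) ∧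
    -- the double extension may be taken on `V` itself, with the same operator `D`, and with
    -- `κ(x,y) = Q(η x, η y)`, where `Q(x,y) = ω(±Dx,y)` and `Q(η x, y) = ω(x,y)`
    (S.HasNontrivialSemiEquicontinuousOrbit →
      ∃ ε : ℝ, (ε = 1 ∨ ε = -1) ∧ (∀ x, x ≠ 0 → 0 < S.ω (ε • S.D x) x) ∧
        ∃ (H : Type u) (_ : NormedAddCommGroup H) (_ : InnerProductSpace ℝ H)
          (ι : V →ₗ[ℝ] H) (η : V →L[ℝ] H) (T : DoubleExtData V),
          IsHilbertCompletion (fun x y => S.ω (ε • S.D x) y) ι ∧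
          (∀ x y, inner ℝ (η x) (ι y) = S.ω x y) ∧
          (∀ x y, T.κ x y = inner ℝ (η x) (η y)) ∧
          T.D = S.D ∧
          (∀ t x y, T.κ (S.γ t x) (S.γ t y) = T.κ x y) ∧
          S.toHeis.TopLieIso T.toHeis) := by
  refine ⟨⟨fun h => ?_, ?_⟩, S.exists_doubleExt_of_orbit⟩
  · obtain ⟨ε, -, -, H, _, _, ι, η, T, -, -, -, -, -, hT⟩ := S.exists_doubleExt_of_orbit h
    exact ⟨V, _, _, _, inferInstance, inferInstance, inferInstance, inferInstance, T, hT⟩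
  · rintro ⟨W, _, _, _, -, -, -, -, T, hT⟩
    exact S.hasOrbit_of_topLieIso T hT
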